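/- **Corollary 1.3.** Let $n\ge 1$, let $\Gamma\subset\mathbb R^n$ be an open symmetric cone containing $\Gamma_+=\{\lambda\in\mathbb R^n:\lambda_i>0 \text{ for all } i\}$, and let $\gamma:\Gamma\to(0,\infty)$ satisfy: a) $\gamma$ is smooth and symmetric, i.e. invariant under permutations of $(\lambda_1,\dots,\lambda_n)$; b) $\gamma$ is $\alpha$-homogeneous, i.e. $\gamma(c\lambda)=c^\alpha\gamma(\lambda)$ for all $\lambda\in\Gamma$ and $c>0$; c) $\dfrac{\partial\gamma}{\partial\lambda_i}(\lambda)>0$ for all $\lambda\in\Gamma$ and $i=1,\dots,n$; d) $\gamma$ has a continuous extension $\gamma:\overline\Gamma\to[0,\infty)$ that vanishes on $\partial\Gamma$; where $\alpha>\tfrac12$. For a smooth function $u:\Omega\to\mathbb R$ on an open set $\Omega\subset\mathbb R^n$, let $\nu=(-Du,1)/\sqrt{1+|Du|^2}$ be the upward unit normal of its graph, and let $\lambda=(\lambda_1,\dots,\lambda_n)$ be the principal curvatures of the graph with respect to $\nu$, i.e. the eigenvalues of the Weingarten map $h^i_j=g^{ik}h_{kj}$, with signs such that the graph of a convex function has $\lambda_i\ge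 0$. The graph is a *$\gamma$-translator* (in the direction $e_{n+1}$) if $\lambda\in\overline\Gamma$ and $$\gamma(\lambda)=\langle\nu,e_{n+1}\rangle$$ at each of its points. It is *convex* if $\lambda_i\ge0$, and *strictly convex* if $\lambda_i>0$, for all $i$ at each of its points; it is *complete* if it is complete for its intrinsic distance; and it is *entire* if $\Omega=\mathbb R^n$. Assume that the bowl-type $\gamma$-translator is defined in a ball, that is: for some $r>0$ there is a function $b$ on the ball $B(0,r)\subset\mathbb R^n$ whose graph is a complete, rotationally symmetric (about the $x_{n+1}$-axis), strictly convex $\gamma$-translator. Then there is no complete convex entire $\gamma$-translator in $\mathbb R^{n+1}$. -/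

import Mathlib

open Set Filter Topology
open scoped ENNReal ContDiff

noncomputable section

namespace GammaTranslator

/-- `ℝⁿ`, the horizontal hyperplane. -/
abbrev Base (n : ℕ) := EuclideanSpace ℝ (Fin n)

/-- The ambient space `ℝⁿ⁺¹`; its last coordinate is the vertical one. -/
abbrev Ambient (n : ℕ) := EuclideanSpace ℝ (Fin (n + 1))

/-- The point `(x, t)` of `ℝⁿ⁺¹` with horizontal part `x` and height `t`. -/
def point {n : ℕ} (x : Base n) (t : ℝ) : Ambient n :=
  WithLp.toLp 2 (Fin.snoc (α := fun _ => ℝ) (fun i => x i) t)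

/-- The vertical unit vector `e_{n+1}`. -/
def vertical (n : ℕ) : Ambient n := point 0 1

/-! ### Curvature functions -/

/-- `γ` is an admissible curvature function on the cone `Γ`, homogeneous of degree `α`.
The function `γ` is positive on `Γ`, and its values on `closure Γ` are those of its continuous
extension, which is zero on the boundary; its values outside `closure Γ` play no role. -/
structure IsCurvatureFunction {n : ℕ} (Γ : Set (Fin n → ℝ)) (γ : (Fin n → ℝ) → ℝ) (α : ℝ) :
    Prop where
  isOpen_cone : IsOpen Γ
  smul_mem : ∀ κ ∈ Γ, ∀ c : ℝ, 0 < c → c • κ ∈ Γ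
  perm_mem : ∀ κ ∈ Γ, ∀ σ : Equiv.Perm (Fin n), κ ∘ σ ∈ Γ
  positive_cone_subset : {κ : Fin n → ℝ | ∀ i, 0 < κ i} ⊆ Γ
  pos : ∀ κ ∈ Γ, 0 < γ κ
  smooth : ContDiffOn ℝ ∞ γ Γ
  symmetric : ∀ κ ∈ Γ, ∀ σ : Equiv.Perm (Fin n), γ (κ ∘ σ) = γ κ
  degree_pos : 0 < α
  homogeneous : ∀ κ ∈ Γ, ∀ c : ℝ, 0 < c → γ (c • κ) = c ^ α * γ κ
  increasing : ∀ κ ∈ Γ, ∀ i, 0 < fderiv ℝ γ κ (Pi.single i 1)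
  continuousOn_closure : ContinuousOn γ (closure Γ)
  eq_zero_of_mem_frontier : ∀ κ ∈ frontier Γ, γ κ = 0

/-! ### Geometry of graphs -/

section Graph

variable {n : ℕ}

/-- The parametrization `x ↦ (x, u x)` of the graph of `u`. -/
def graphMap (u : Base n → ℝ) (x : Base n) : Ambient n := point x (u x)

/-- The graph of `u` over `Ω`, a subset of `ℝⁿ⁺¹`. -/
def graphOver (Ω : Set (Base n)) (u : Base n → ℝ) : Set (Ambient n) := graphMap u '' Ω

/-- The `i`-th partial derivative of a map defined on (a subset of) `ℝⁿ`. -/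
def pderiv {E : Type*} [NormedAddCommGroup E] [NormedSpace ℝ E] (i : Fin n) (F : Base n → E)
    (x : Base n) : E :=
  fderiv ℝ F x (EuclideanSpace.single i 1)

/-- The upward unit normal `(-∇u, 1) / √(1 + |∇u|²)` of the graph of `u`; for a convex graph it
is the inward one. -/
def unitNormal (u : Base n → ℝ) (x : Base n) : Ambient n :=
  (1 / Real.sqrt (1 + ‖gradient u x‖ ^ 2)) • point (-gradient u x) 1

/-- The metric tensor `g_{ij} = ⟨∂_i F, ∂_j F⟩` of the graph, `F = graphMap u`. -/
def metricTensor (u : Base n → ℝ) (x : Base n) : Matrix (Fin n) (Fin n) ℝ :=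
  Matrix.of fun i j => inner ℝ (pderiv i (graphMap u) x) (pderiv j (graphMap u) x)

/-- The second fundamental form `h_{ij} = ⟨∂_i ∂_j F, ν⟩` of the graph with respect to the
upward unit normal `ν` (so that graphs of convex functions have nonnegative `h`). -/
def secondFundamentalForm (u : Base n → ℝ) (x : Base n) : Matrix (Fin n) (Fin n) ℝ :=
  Matrix.of fun i j => inner ℝ (pderiv i (pderiv j (graphMap u)) x) (unitNormal u x)

/-- The Weingarten map `h^i_j = g^{ik} h_{kj}`. -/
def weingarten (u : Base n → ℝ) (x : Base n) : Matrix (Fin n) (Fin n) ℝ :=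
  (metricTensor u x)⁻¹ * secondFundamentalForm u x

/-- `κ = (κ₁, …, κₙ)` lists the principal curvatures of the graph of `u` over `x`: the
eigenvalues of the Weingarten map, with multiplicity (in some order). -/
def IsPrincipalCurvatureVector (u : Base n → ℝ) (x : Base n) (κ : Fin n → ℝ) : Prop :=
  (weingarten u x).charpoly = ∏ i, (Polynomial.X - Polynomial.C (κ i))

/-- The graph of `u` over `Ω` is convex: its principal curvatures are nonnegative. -/
def IsConvexGraph (Ω : Set (Base n)) (u : Base n → ℝ) : Prop :=
  ∀ x ∈ Ω, ∀ κ, IsPrincipalCurvatureVector u x κ → ∀ i, 0 ≤ κ i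

/-- The graph of `u` over `Ω` is strictly convex: its principal curvatures are positive. -/
def IsStrictlyConvexGraph (Ω : Set (Base n)) (u : Base n → ℝ) : Prop :=
  ∀ x ∈ Ω, ∀ κ, IsPrincipalCurvatureVector u x κ → ∀ i, 0 < κ i

/-- The intrinsic distance of `S ⊆ ℝⁿ⁺¹`: the infimum of the lengths of the paths in `S`. -/
def intrinsicEDist (S : Set (Ambient n)) (p q : Ambient n) : ℝ≥0∞ :=
  ⨅ c ∈ {c : ℝ → Ambient n |
    ContinuousOn c (Icc 0 1) ∧ MapsTo c (Icc 0 1) S ∧ c 0 = p ∧ c 1 = q},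
    eVariationOn c (Icc 0 1)

/-- `S` is complete for its intrinsic distance: intrinsic Cauchy sequences converge in `S`. -/
def IsIntrinsicallyComplete (S : Set (Ambient n)) : Prop :=
  ∀ s : ℕ → Ambient n, (∀ k, s k ∈ S) →
    (∀ ε : ℝ≥0∞, 0 < ε → ∃ N, ∀ k ≥ N, ∀ m ≥ N, intrinsicEDist S (s k) (s m) < ε) →
    ∃ p ∈ S, Tendsto (fun k => intrinsicEDist S (s k) p) atTop (𝓝 0)

/-- The graph of `u` over the open set `Ω` is a `γ`-translator in direction `e_{n+1}`: it is
smooth and `γ(κ) = ⟨ν, e_{n+1}⟩` at each point, `κ` being the principal curvature vector. -/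
structure IsGraphicalTranslator (Γ : Set (Fin n → ℝ)) (γ : (Fin n → ℝ) → ℝ)
    (Ω : Set (Base n)) (u : Base n → ℝ) : Prop where
  smooth : ContDiffOn ℝ ∞ u Ω
  equation : ∀ x ∈ Ω, ∃ κ, IsPrincipalCurvatureVector u x κ ∧ κ ∈ closure Γ ∧
    γ κ = inner ℝ (unitNormal u x) (vertical n)

/-- The graph of `b` is a bowl-type `γ`-translator defined in the ball of radius `r` about the
origin: a complete, rotationally symmetric, strictly convex graphical `γ`-translator over it. -/
structure IsBowlOverBall (Γ : Set (Fin n → ℝ)) (γ : (Fin n → ℝ) → ℝ)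
    (r : ℝ) (b : Base n → ℝ) : Prop where
  translator : IsGraphicalTranslator Γ γ (Metric.ball 0 r) b
  rotationally_symmetric :
    ∀ x ∈ Metric.ball (0 : Base n) r, ∀ y ∈ Metric.ball (0 : Base n) r, ‖x‖ = ‖y‖ → b x = b y
  strictly_convex : IsStrictlyConvexGraph (Metric.ball 0 r) b
  complete : IsIntrinsicallyComplete (graphOver (Metric.ball 0 r) b)

/-- The graph of `u` is a complete convex entire `γ`-translator. -/
structure IsCompleteConvexEntireTranslator (Γ : Set (Fin n → ℝ)) (γ : (Fin n → ℝ) → ℝ)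
    (u : Base n → ℝ) : Prop where
  translator : IsGraphicalTranslator Γ γ univ u
  convex : IsConvexGraph univ u
  complete : IsIntrinsicallyComplete (graphOver univ u)

end Graph

end GammaTranslator

end

/-
Dilate the bowl by a factor `c > 1` so close to `1` that the ball of radius `c r` still lies in the
domain of the other translator `u`. Completeness forces the bowl, which is radially increasing by
convexity, to tend to infinity at the boundary of its ball: a bounded profile would have finite
length. Hence some vertical translate of the dilated bowl touches the graph of `u` from above. At
the contact point the normals agree, and by Weyl's inequality the principal curvatures `κ` of `u`
are at most `c⁻¹ μ` up to a permutation, where `μ` are those of the bowl at the corresponding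
point. Monotonicity and homogeneity of `γ` give `γ κ ≤ c ^ (-α) γ μ < γ μ`, whereas the translator
equations give `γ κ = ⟨ν, e_{n+1}⟩ = γ μ`.
-/

namespace GammaTranslator

section LinearAlgebra

theorem exists_ne_zero_repr_eq_zero {K V : Type*} [DivisionRing K] [AddCommGroup V] [Module K V]
    {n : ℕ} (e f : Module.Basis (Fin n) K V) (k : Fin n) :
    ∃ x ≠ 0, (∀ i < k, e.repr x i = 0) ∧ ∀ i > k, f.repr x i = 0 := by
  have : FiniteDimensional K V := e.finiteDimensional_of_finite
  let L : V →ₗ[K] ({i : Fin n // i ≠ k} → K) := LinearMap.pi fun i =>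
    if (i : Fin n) < k then e.coord i else f.coord i
  have hlt : Module.finrank K ({i : Fin n // i ≠ k} → K) < Module.finrank K V := by
    simpa [Module.finrank_eq_card_basis e] using k.pos
  obtain ⟨x, hx, hx0⟩ := Submodule.exists_mem_ne_zero_of_ne_bot
    (LinearMap.ker_ne_bot_of_finrank_lt (f := L) hlt)
  have hL (i : {i : Fin n // i ≠ k}) : L x i = 0 := congrFun (LinearMap.mem_ker.1 hx) i
  refine ⟨x, hx0, fun i hi => ?_, fun i hi => ?_⟩
  · simpa [L, hi] using hL ⟨i, hi.ne⟩
  · simpa [L, hi.not_gt] using hL ⟨i, hi.ne'⟩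

section Operators

variable {𝕜 E : Type*} [RCLike 𝕜] [NormedAddCommGroup E] [InnerProductSpace 𝕜 E]
  [FiniteDimensional 𝕜 E] {n : ℕ} {S T : E →ₗ[𝕜] E}

theorem re_inner_apply_self_eq_sum (hT : T.IsSymmetric) (hn : Module.finrank 𝕜 E = n) (x : E) :
    RCLike.re (inner 𝕜 (T x) x) =
      ∑ i, hT.eigenvalues hn i * ‖(hT.eigenvectorBasis hn).repr x i‖ ^ 2 := by
  rw [← (hT.eigenvectorBasis hn).repr.inner_map_map, PiLp.inner_apply, map_sum]
  refine Finset.sum_congr rfl fun i _ => ?_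
  rw [hT.eigenvectorBasis_apply_self_apply, RCLike.inner_apply, map_mul (starRingEnd 𝕜),
    RCLike.conj_ofReal, mul_left_comm, RCLike.mul_conj, RCLike.re_ofReal_mul]
  norm_cast

theorem re_inner_apply_self_le (hT : T.IsSymmetric) (hn : Module.finrank 𝕜 E = n) {k : Fin n}
    {x : E} (hx : ∀ i < k, (hT.eigenvectorBasis hn).repr x i = 0) :
    RCLike.re (inner 𝕜 (T x) x) ≤ hT.eigenvalues hn k * ‖x‖ ^ 2 := by
  rw [re_inner_apply_self_eq_sum hT hn, ← (hT.eigenvectorBasis hn).repr.norm_map,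
    EuclideanSpace.norm_sq_eq, Finset.mul_sum]
  refine Finset.sum_le_sum fun i _ => ?_
  rcases lt_or_ge i k with hi | hi
  · simp [hx i hi]
  · gcongr
    exact hT.eigenvalues_antitone hn hi

theorem le_re_inner_apply_self (hT : T.IsSymmetric) (hn : Module.finrank 𝕜 E = n) {k : Fin n}
    {x : E} (hx : ∀ i > k, (hT.eigenvectorBasis hn).repr x i = 0) :
    hT.eigenvalues hn k * ‖x‖ ^ 2 ≤ RCLike.re (inner 𝕜 (T x) x) := by
  rw [re_inner_apply_self_eq_sum hT hn, ← (hT.eigenvectorBasis hn).repr.norm_map,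
    EuclideanSpace.norm_sq_eq, Finset.mul_sum]
  refine Finset.sum_le_sum fun i _ => ?_
  rcases lt_or_ge k i with hi | hi
  · simp [hx i hi]
  · gcongr
    exact hT.eigenvalues_antitone hn hi

/-- Weyl's monotonicity principle. -/
theorem eigenvalues_le_of_re_inner_le (hS : S.IsSymmetric) (hT : T.IsSymmetric)
    (hn : Module.finrank 𝕜 E = n)
    (h : ∀ x, RCLike.re (inner 𝕜 (S x) x) ≤ RCLike.re (inner 𝕜 (T x) x)) :
    hS.eigenvalues hn ≤ hT.eigenvalues hn := fun k => by
  obtain ⟨x, hx0, hTx, hSx⟩ := exists_ne_zero_repr_eq_zero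
    (hT.eigenvectorBasis hn).toBasis (hS.eigenvectorBasis hn).toBasis k
  have hle : hS.eigenvalues hn k * ‖x‖ ^ 2 ≤ hT.eigenvalues hn k * ‖x‖ ^ 2 :=
    (le_re_inner_apply_self hS hn (by simpa using hSx)).trans
      ((h x).trans (re_inner_apply_self_le hT hn (by simpa using hTx)))
  exact le_of_mul_le_mul_right hle (by positivity)

end Operators

section Matrices

open Polynomial Matrix
open scoped MatrixOrder ComplexOrder

variable {𝕜 ι : Type*} [RCLike 𝕜] [Fintype ι] [DecidableEq ι]

theorem eigenvalues_le_of_le {A B : Matrix ι ι 𝕜} (hA : A.IsHermitian) (hB : B.IsHermitian)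
    (h : A ≤ B) : hA.eigenvalues ≤ hB.eigenvalues := fun i => by
  refine eigenvalues_le_of_re_inner_le _ _ _ (fun x => ?_) _
  have hpos := (Matrix.le_iff.1 h).re_dotProduct_nonneg x.ofLp
  rw [sub_mulVec, dotProduct_sub, map_sub, sub_nonneg] at hpos
  rw [inner_re_symm, inner_re_symm (𝕜 := 𝕜) _ x]
  simpa [EuclideanSpace.inner_eq_star_dotProduct, toLpLin_apply, dotProduct_comm] using hpos

theorem exists_perm_comp_eq_of_map_eq {ι α : Type*} [Fintype ι] {f g : ι → α}
    (h : Finset.univ.val.map f = Finset.univ.val.map g) : ∃ σ : Equiv.Perm ι, f ∘ σ = g := by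
  classical
  have hcard (y : α) : Nonempty ({i // g i = y} ≃ {i // f i = y}) := by
    have hy := congrArg (Multiset.count y) h
    rw [Multiset.count_map, Multiset.count_map] at hy
    refine ⟨Fintype.equivOfCardEq ?_⟩
    rw [Fintype.card_subtype, Fintype.card_subtype, Finset.card_def, Finset.card_def]
    simpa [Finset.filter_val, eq_comm] using hy.symm
  exact ⟨Equiv.ofFiberEquiv fun y => (hcard y).some,
    funext fun i => Equiv.ofFiberEquiv_map (fun y => (hcard y).some) i⟩

theorem exists_perm_eigenvalues_comp_eq {A : Matrix ι ι 𝕜} (hA : A.IsHermitian) {κ : ι → ℝ}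
    (hκ : A.charpoly = ∏ i, (X - C (κ i : 𝕜))) :
    ∃ σ : Equiv.Perm ι, hA.eigenvalues ∘ σ = κ := by
  refine exists_perm_comp_eq_of_map_eq
    (Multiset.map_injective (RCLike.ofReal_injective (K := 𝕜)) ?_)
  rw [Multiset.map_map, ← hA.roots_charpoly_eq_eigenvalues, hκ, Polynomial.roots_prod]
  · simp
  · simp [Finset.prod_ne_zero_iff, X_sub_C_ne_zero]

/-- With `g⁻¹ = C Cᴴ`, the matrices `g⁻¹ h = C (Cᴴ h)` and `Cᴴ h C` have the same eigenvalues. -/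
theorem exists_isUnit_charpoly_inv_mul_eq {g : Matrix ι ι 𝕜} (hg : g.PosDef) :
    ∃ C : Matrix ι ι 𝕜, IsUnit C ∧
      ∀ h : Matrix ι ι 𝕜, (g⁻¹ * h).charpoly = (star C * h * C).charpoly := by
  obtain ⟨C, hC⟩ := CStarAlgebra.nonneg_iff_eq_mul_star_self.1 hg.inv.posSemidef.nonneg
  refine ⟨C, ?_, fun h => by rw [hC, mul_assoc, charpoly_mul_comm]⟩
  have hdet := (isUnit_iff_isUnit_det _).1 hg.inv.isUnit
  rw [hC, det_mul] at hdet
  exact (isUnit_iff_isUnit_det _).2 (isUnit_of_mul_isUnit_left hdet)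

theorem exists_perm_le_of_charpoly_inv_mul {g A B : Matrix ι ι 𝕜} (hg : g.PosDef)
    (hA : A.IsHermitian) (hB : B.IsHermitian) (hAB : A ≤ B) {κ μ : ι → ℝ}
    (hκ : (g⁻¹ * A).charpoly = ∏ i, (X - C (κ i : 𝕜)))
    (hμ : (g⁻¹ * B).charpoly = ∏ i, (X - C (μ i : 𝕜))) :
    ∃ τ : Equiv.Perm ι, κ ≤ μ ∘ τ := by
  obtain ⟨C, -, hC⟩ := exists_isUnit_charpoly_inv_mul_eq hg
  rw [hC] at hκ hμ
  have hA' := isHermitian_conjTranspose_mul_mul C hA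
  have hB' := isHermitian_conjTranspose_mul_mul C hB
  obtain ⟨σ, rfl⟩ := exists_perm_eigenvalues_comp_eq hA' hκ
  obtain ⟨ρ, rfl⟩ := exists_perm_eigenvalues_comp_eq hB' hμ
  refine ⟨σ.trans ρ.symm, fun i => ?_⟩
  simpa using eigenvalues_le_of_le hA' hB' (star_left_conjugate_le_conjugate hAB C) (σ i)

theorem posSemidef_of_charpoly_inv_mul {g A : Matrix ι ι 𝕜} (hg : g.PosDef)
    (hA : A.IsHermitian) {κ : ι → ℝ} (hκ : (g⁻¹ * A).charpoly = ∏ i, (X - C (κ i : 𝕜)))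
    (hκ0 : 0 ≤ κ) : A.PosSemidef := by
  obtain ⟨C, hCu, hC⟩ := exists_isUnit_charpoly_inv_mul_eq hg
  rw [hC] at hκ
  have hA' := isHermitian_conjTranspose_mul_mul C hA
  obtain ⟨σ, rfl⟩ := exists_perm_eigenvalues_comp_eq hA' hκ
  rw [← hCu.posSemidef_star_left_conjugate_iff]
  refine hA'.posSemidef_iff_eigenvalues_nonneg.2 fun i => ?_
  simpa using hκ0 (σ.symm i)

theorem charpoly_smul_eq_prod {K : Type*} [Field K] [Infinite K] {A : Matrix ι ι K} {κ : ι → K}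
    (hκ : A.charpoly = ∏ i, (X - C (κ i))) {c : K} (hc : c ≠ 0) :
    (c • A).charpoly = ∏ i, (X - C (c * κ i)) := by
  refine Polynomial.funext fun t => ?_
  have hfactor : scalar ι t - c • A = c • (scalar ι (c⁻¹ * t) - A) := by
    rw [smul_sub, scalar_apply, scalar_apply, ← diagonal_smul]
    congr
    ext
    simp [hc]
  rw [eval_charpoly, hfactor, det_smul, ← eval_charpoly, hκ, eval_prod, eval_prod,
    ← Finset.card_univ, ← Finset.prod_const, ← Finset.prod_mul_distrib]
  refine Finset.prod_congr rfl fun i _ => ?_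
  simp only [eval_sub, eval_X, eval_C]
  field_simp

end Matrices

end LinearAlgebra

section SecondDerivative

theorem deriv_deriv_nonneg_of_isLocalMin {f : ℝ → ℝ} {a : ℝ} (hmin : IsLocalMin f a)
    (hf : ContinuousAt f a) : 0 ≤ deriv (deriv f) a := by
  by_contra! hneg
  have hmax : IsLocalMax f a := isLocalMax_of_deriv_deriv_neg hneg hmin.deriv_eq_zero hf
  have hconst : f =ᶠ[𝓝 a] fun _ => f a := by
    filter_upwards [hmin, hmax] with s h₁ h₂ using le_antisymm h₂ h₁
  have hzero : deriv (deriv f) a = 0 := by simp [hconst.deriv.deriv_eq]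
  exact hneg.ne hzero

variable {E : Type*} [NormedAddCommGroup E] [NormedSpace ℝ E] {F : Type*} [NormedAddCommGroup F]
  [NormedSpace ℝ F] {φ : E → F} {f g : E → ℝ} {x v : E}

theorem hasDerivAt_comp_add_smul {t : ℝ} (hφ : DifferentiableAt ℝ φ (x + t • v)) :
    HasDerivAt (fun s : ℝ => φ (x + s • v)) (fderiv ℝ φ (x + t • v) v) t := by
  have hline : HasDerivAt (fun s : ℝ => x + s • v) v t := by
    simpa using ((hasDerivAt_id t).smul_const v).const_add x
  exact hφ.hasFDerivAt.comp_hasDerivAt t hline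

theorem differentiableAt_fderiv (hφ : ContDiffAt ℝ 2 φ x) : DifferentiableAt ℝ (fderiv ℝ φ) x :=
  (hφ.fderiv_right (m := 1) (by norm_num)).differentiableAt one_ne_zero

theorem eventually_differentiableAt (hφ : ContDiffAt ℝ 2 φ x) :
    ∀ᶠ y in 𝓝 x, DifferentiableAt ℝ φ y := by
  filter_upwards [hφ.eventually (by simp)] with y hy using hy.differentiableAt two_ne_zero

theorem hasDerivAt_deriv_comp_add_smul {t : ℝ} (hφ : ContDiffAt ℝ 2 φ (x + t • v)) :
    HasDerivAt (deriv fun s : ℝ => φ (x + s • v)) (fderiv ℝ (fderiv ℝ φ) (x + t • v) v v) t := by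
  have hderiv := (hasDerivAt_comp_add_smul (differentiableAt_fderiv hφ)).clm_apply
    (hasDerivAt_const t v)
  rw [map_zero, add_zero] at hderiv
  refine hderiv.congr_of_eventuallyEq ?_
  have hline : ContinuousAt (fun s : ℝ => x + s • v) t := by fun_prop
  filter_upwards [hline.eventually (eventually_differentiableAt hφ)] with s hs
    using (hasDerivAt_comp_add_smul hs).deriv

theorem fderiv_fderiv_nonneg_of_isLocalMin (hmin : IsLocalMin f x) (hf : ContDiffAt ℝ 2 f x)
    (v : E) : 0 ≤ fderiv ℝ (fderiv ℝ f) x v v := by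
  have hx : x + (0 : ℝ) • v = x := by simp
  rw [← hx] at hf hmin
  have hline : ContinuousAt (fun s : ℝ => x + s • v) 0 := by fun_prop
  have hmin' : IsLocalMin (fun s : ℝ => f (x + s • v)) 0 := hline.eventually hmin
  have hcont : ContinuousAt (fun s : ℝ => f (x + s • v)) 0 :=
    ContinuousAt.comp' (f := fun s : ℝ => x + s • v) hf.continuousAt hline
  simpa only [(hasDerivAt_deriv_comp_add_smul hf).deriv, hx] using
    deriv_deriv_nonneg_of_isLocalMin hmin' hcont

theorem fderiv_eq_of_isLocalMin_sub (hf : DifferentiableAt ℝ f x) (hg : DifferentiableAt ℝ g x)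
    (hmin : IsLocalMin (g - f) x) : fderiv ℝ f x = fderiv ℝ g x := by
  have hzero := hmin.fderiv_eq_zero
  rw [fderiv_sub hg hf] at hzero
  exact (sub_eq_zero.1 hzero).symm

theorem fderiv_fderiv_le_of_isLocalMin_sub (hf : ContDiffAt ℝ 2 f x) (hg : ContDiffAt ℝ 2 g x)
    (hmin : IsLocalMin (g - f) x) (v : E) :
    fderiv ℝ (fderiv ℝ f) x v v ≤ fderiv ℝ (fderiv ℝ g) x v v := by
  have hnonneg := fderiv_fderiv_nonneg_of_isLocalMin hmin (hg.sub hf) v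
  have hsub : fderiv ℝ (g - f) =ᶠ[𝓝 x] fderiv ℝ g - fderiv ℝ f := by
    filter_upwards [eventually_differentiableAt hf, eventually_differentiableAt hg] with y hfy hgy
      using fderiv_sub hgy hfy
  rw [hsub.fderiv_eq, fderiv_sub (differentiableAt_fderiv hg) (differentiableAt_fderiv hf)]
    at hnonneg
  exact sub_nonneg.1 hnonneg

theorem convexOn_comp_add_smul {Ω : Set E} (hf : ∀ x ∈ Ω, ContDiffAt ℝ 2 f x)
    (hf'' : ∀ x ∈ Ω, 0 ≤ fderiv ℝ (fderiv ℝ f) x v v) {D : Set ℝ}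
    (hD : Convex ℝ D) (hDΩ : ∀ t ∈ D, x + t • v ∈ Ω) :
    ConvexOn ℝ D fun t => f (x + t • v) := by
  have hderiv (t : ℝ) (ht : t ∈ D) := hasDerivAt_comp_add_smul (v := v)
    ((hf _ (hDΩ t ht)).differentiableAt two_ne_zero)
  have hderiv2 (t : ℝ) (ht : t ∈ D) := hasDerivAt_deriv_comp_add_smul (hf _ (hDΩ t ht))
  refine convexOn_of_deriv2_nonneg' hD
    (fun t ht => (hderiv t ht).differentiableAt.differentiableWithinAt)
    (fun t ht => (hderiv2 t ht).differentiableAt.differentiableWithinAt) fun t ht => ?_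
  simpa only [Function.iterate_succ, Function.iterate_zero, Function.comp_apply, id,
    (hderiv2 t ht).deriv] using hf'' _ (hDΩ t ht)

end SecondDerivative

section GraphGeometry

open scoped Matrix

variable {n : ℕ} {u v : Base n → ℝ} {x : Base n}

theorem inner_point (x y : Base n) (s t : ℝ) :
    inner ℝ (point x s) (point y t) = inner ℝ x y + s * t := by
  simp [point, PiLp.inner_apply, Fin.sum_univ_castSucc, mul_comm]

theorem dist_point_sq (x y : Base n) (s t : ℝ) :
    dist (point x s) (point y t) ^ 2 = dist x y ^ 2 + (s - t) ^ 2 := by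
  rw [EuclideanSpace.dist_eq, EuclideanSpace.dist_eq, Real.sq_sqrt (by positivity),
    Real.sq_sqrt (by positivity)]
  simp [point, Fin.sum_univ_castSucc, Real.dist_eq]

/-- The identification `ℝⁿ × ℝ ≃ ℝⁿ⁺¹`, `(x, t) ↦ point x t`, as a continuous linear map. -/
noncomputable def pointCLM (n : ℕ) : Base n × ℝ →L[ℝ] Ambient n :=
  LinearMap.toContinuousLinearMap
    { toFun := fun p => point p.1 p.2
      map_add' := fun p q => by
        ext i
        refine Fin.lastCases ?_ (fun j => ?_) i <;> simp [point]
      map_smul' := fun c p => by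
        ext i
        refine Fin.lastCases ?_ (fun j => ?_) i <;> simp [point] }

@[simp]
theorem pointCLM_apply (p : Base n × ℝ) : pointCLM n p = point p.1 p.2 := rfl

theorem pderiv_graphMap (hu : DifferentiableAt ℝ u x) (i : Fin n) :
    pderiv i (graphMap u) x =
      point (EuclideanSpace.single i 1) (fderiv ℝ u x (EuclideanSpace.single i 1)) := by
  have hderiv : HasFDerivAt (graphMap u)
      ((pointCLM n).comp ((ContinuousLinearMap.id ℝ (Base n)).prod (fderiv ℝ u x))) x :=
    (pointCLM n).hasFDerivAt.comp x ((hasFDerivAt_id x).prodMk hu.hasFDerivAt)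
  rw [pderiv, hderiv.fderiv]
  rfl

theorem pderiv_pderiv_graphMap (hu : ContDiffAt ℝ 2 u x) (i j : Fin n) :
    pderiv i (pderiv j (graphMap u)) x =
      point 0 (fderiv ℝ (fderiv ℝ u) x (EuclideanSpace.single i 1)
        (EuclideanSpace.single j 1)) := by
  set e : Base n := EuclideanSpace.single j 1
  have hpderiv : pderiv j (graphMap u) =ᶠ[𝓝 x] fun y => pointCLM n (e, fderiv ℝ u y e) := by
    filter_upwards [eventually_differentiableAt hu] with y hy using pderiv_graphMap hy j
  have hderiv : HasFDerivAt (fun y => pointCLM n (e, fderiv ℝ u y e)) _ x :=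
    (pointCLM n).hasFDerivAt.comp x ((hasFDerivAt_const e x).prodMk
      ((differentiableAt_fderiv hu).hasFDerivAt.clm_apply (hasFDerivAt_const e x)))
  rw [pderiv, hpderiv.fderiv_eq, hderiv.fderiv]
  simp

theorem inner_unitNormal_vertical (u : Base n → ℝ) (x : Base n) :
    inner ℝ (unitNormal u x) (vertical n) = 1 / √(1 + ‖gradient u x‖ ^ 2) := by
  rw [unitNormal, vertical, inner_smul_left, inner_point]
  simp

theorem inner_unitNormal_vertical_pos (u : Base n → ℝ) (x : Base n) :
    0 < inner ℝ (unitNormal u x) (vertical n) := by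
  rw [inner_unitNormal_vertical]
  positivity

theorem secondFundamentalForm_apply (hu : ContDiffAt ℝ 2 u x) (i j : Fin n) :
    secondFundamentalForm u x i j = inner ℝ (unitNormal u x) (vertical n) *
      fderiv ℝ (fderiv ℝ u) x (EuclideanSpace.single i 1) (EuclideanSpace.single j 1) := by
  rw [secondFundamentalForm, Matrix.of_apply, pderiv_pderiv_graphMap hu, unitNormal, vertical,
    inner_smul_right, inner_smul_left, inner_point, inner_point]
  simp

theorem metricTensor_eq (hu : DifferentiableAt ℝ u x) :
    metricTensor u x = 1 + Matrix.vecMulVec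
      (fun i => fderiv ℝ u x (EuclideanSpace.single i 1))
      (fun i => fderiv ℝ u x (EuclideanSpace.single i 1)) := by
  ext i j
  rw [metricTensor, Matrix.of_apply, pderiv_graphMap hu, pderiv_graphMap hu, inner_point]
  simp [Matrix.one_apply, Matrix.vecMulVec_apply, EuclideanSpace.inner_single_left]

theorem posDef_metricTensor (hu : DifferentiableAt ℝ u x) : (metricTensor u x).PosDef := by
  rw [metricTensor_eq hu]
  refine Matrix.PosDef.one.add_posSemidef ?_
  simpa using Matrix.posSemidef_vecMulVec_self_star
    (fun i => fderiv ℝ u x (EuclideanSpace.single i 1))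

theorem isHermitian_secondFundamentalForm (hu : ContDiffAt ℝ 2 u x) :
    (secondFundamentalForm u x).IsHermitian := by
  ext i j
  rw [Matrix.conjTranspose_apply, secondFundamentalForm_apply hu, secondFundamentalForm_apply hu,
    (hu.isSymmSndFDerivAt (by simp)).eq, star_trivial]

theorem dotProduct_secondFundamentalForm_mulVec (hu : ContDiffAt ℝ 2 u x) (w : Base n) :
    w.ofLp ⬝ᵥ secondFundamentalForm u x *ᵥ w.ofLp =
      inner ℝ (unitNormal u x) (vertical n) * fderiv ℝ (fderiv ℝ u) x w w := by
  have hw : ∑ i, w i • EuclideanSpace.single i (1 : ℝ) = w := by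
    simpa using (EuclideanSpace.basisFun (Fin n) ℝ).sum_repr w
  conv_rhs => rw [← hw]
  simp only [dotProduct, Matrix.mulVec, secondFundamentalForm_apply hu, map_sum, map_smul,
    sum_apply, smul_apply, smul_eq_mul, Finset.mul_sum]
  rw [Finset.sum_comm]
  refine Finset.sum_congr rfl fun i _ => Finset.sum_congr rfl fun j _ => ?_
  ring

theorem IsPrincipalCurvatureVector.fderiv_fderiv_nonneg {κ : Fin n → ℝ}
    (hκ : IsPrincipalCurvatureVector u x κ) (hu : ContDiffAt ℝ 2 u x) (hκ0 : 0 ≤ κ) (w : Base n) :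
    0 ≤ fderiv ℝ (fderiv ℝ u) x w w := by
  have hpos := (posSemidef_of_charpoly_inv_mul (posDef_metricTensor
    (hu.differentiableAt two_ne_zero)) (isHermitian_secondFundamentalForm hu) hκ
    hκ0).dotProduct_mulVec_nonneg w.ofLp
  rw [star_trivial, dotProduct_secondFundamentalForm_mulVec hu] at hpos
  exact nonneg_of_mul_nonneg_right hpos (inner_unitNormal_vertical_pos u x)

end GraphGeometry

section Tangency

open scoped Matrix MatrixOrder

variable {n : ℕ} {u v : Base n → ℝ} {x : Base n}

theorem unitNormal_eq_of_isLocalMin_sub (hu : DifferentiableAt ℝ u x)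
    (hv : DifferentiableAt ℝ v x) (hmin : IsLocalMin (v - u) x) :
    unitNormal u x = unitNormal v x := by
  simp only [unitNormal, gradient, fderiv_eq_of_isLocalMin_sub hu hv hmin]

theorem metricTensor_eq_of_isLocalMin_sub (hu : DifferentiableAt ℝ u x)
    (hv : DifferentiableAt ℝ v x) (hmin : IsLocalMin (v - u) x) :
    metricTensor u x = metricTensor v x := by
  rw [metricTensor_eq hu, metricTensor_eq hv, fderiv_eq_of_isLocalMin_sub hu hv hmin]

theorem secondFundamentalForm_le_of_isLocalMin_sub (hu : ContDiffAt ℝ 2 u x)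
    (hv : ContDiffAt ℝ 2 v x) (hmin : IsLocalMin (v - u) x) :
    secondFundamentalForm u x ≤ secondFundamentalForm v x := by
  refine Matrix.le_iff.2 (.of_dotProduct_mulVec_nonneg
    ((isHermitian_secondFundamentalForm hv).sub (isHermitian_secondFundamentalForm hu))
    fun w => ?_)
  have hsff_u := dotProduct_secondFundamentalForm_mulVec hu (WithLp.toLp 2 w)
  have hsff_v := dotProduct_secondFundamentalForm_mulVec hv (WithLp.toLp 2 w)
  rw [unitNormal_eq_of_isLocalMin_sub (hu.differentiableAt two_ne_zero)
    (hv.differentiableAt two_ne_zero) hmin] at hsff_u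
  rw [star_trivial, Matrix.sub_mulVec, dotProduct_sub, hsff_u, hsff_v, ← mul_sub]
  exact mul_nonneg (inner_unitNormal_vertical_pos v x).le
    (sub_nonneg.2 (fderiv_fderiv_le_of_isLocalMin_sub hu hv hmin _))

theorem IsPrincipalCurvatureVector.exists_perm_le_of_isLocalMin_sub {κ μ : Fin n → ℝ}
    (hκ : IsPrincipalCurvatureVector u x κ) (hμ : IsPrincipalCurvatureVector v x μ)
    (hu : ContDiffAt ℝ 2 u x) (hv : ContDiffAt ℝ 2 v x) (hmin : IsLocalMin (v - u) x) :
    ∃ τ : Equiv.Perm (Fin n), κ ≤ μ ∘ τ := by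
  have hu' : DifferentiableAt ℝ u x := hu.differentiableAt two_ne_zero
  have hv' : DifferentiableAt ℝ v x := hv.differentiableAt two_ne_zero
  rw [IsPrincipalCurvatureVector, weingarten,
    metricTensor_eq_of_isLocalMin_sub hu' hv' hmin] at hκ
  exact exists_perm_le_of_charpoly_inv_mul (posDef_metricTensor hv')
    (isHermitian_secondFundamentalForm hu) (isHermitian_secondFundamentalForm hv)
    (secondFundamentalForm_le_of_isLocalMin_sub hu hv hmin) hκ hμ

end Tangency

section Dilation

variable {n : ℕ}

/-- The function whose graph is the image of the graph of `u` under the homothety of ratio `c`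
of `ℝⁿ⁺¹` about the origin, for `c ≠ 0`. -/
noncomputable def dilation (c : ℝ) (u : Base n → ℝ) (x : Base n) : ℝ := c * u (c⁻¹ • x)

variable {c : ℝ} {u : Base n → ℝ}

theorem graphMap_dilation (hc : c ≠ 0) :
    graphMap (dilation c u) = fun x => c • graphMap u (c⁻¹ • x) := by
  ext1 x
  simpa [graphMap, dilation, hc] using
    (pointCLM n).map_smul c (c⁻¹ • x, u (c⁻¹ • x))

theorem contDiffAt_dilation {k : ℕ∞} {x : Base n} (hu : ContDiffAt ℝ k u (c⁻¹ • x)) :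
    ContDiffAt ℝ k (dilation c u) x :=
  contDiffAt_const.mul (hu.comp x (contDiff_const_smul _).contDiffAt)

theorem fderiv_const_smul_comp_smul {E F : Type*} [NormedAddCommGroup E] [NormedSpace ℝ E]
    [NormedAddCommGroup F] [NormedSpace ℝ F] (hc : c ≠ 0) (f : E → F) (x : E) :
    fderiv ℝ (fun x => c • f (c⁻¹ • x)) x = fderiv ℝ f (c⁻¹ • x) := by
  rw [← Pi.smul_def, fderiv_const_smul_field, Pi.smul_apply, fderiv_comp_smul,
    smul_inv_smul₀ hc]

theorem unitNormal_dilation (hc : c ≠ 0) (x : Base n) :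
    unitNormal (dilation c u) x = unitNormal u (c⁻¹ • x) := by
  have hfderiv : fderiv ℝ (dilation c u) x = fderiv ℝ u (c⁻¹ • x) :=
    fderiv_const_smul_comp_smul hc u x
  simp only [unitNormal, gradient, hfderiv]

theorem pderiv_graphMap_dilation (hc : c ≠ 0) (i : Fin n) :
    pderiv i (graphMap (dilation c u)) = fun x => pderiv i (graphMap u) (c⁻¹ • x) := by
  ext1 x
  rw [graphMap_dilation hc, pderiv, fderiv_const_smul_comp_smul hc, pderiv]

theorem metricTensor_dilation (hc : c ≠ 0) (x : Base n) :
    metricTensor (dilation c u) x = metricTensor u (c⁻¹ • x) := by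
  simp only [metricTensor, pderiv_graphMap_dilation hc]

theorem secondFundamentalForm_dilation (hc : c ≠ 0) (x : Base n) :
    secondFundamentalForm (dilation c u) x = c⁻¹ • secondFundamentalForm u (c⁻¹ • x) := by
  ext i j
  rw [secondFundamentalForm, Matrix.of_apply, unitNormal_dilation hc, pderiv_graphMap_dilation hc,
    pderiv, fderiv_comp_smul, smul_apply, inner_smul_left, Matrix.smul_apply]
  rfl

theorem weingarten_dilation (hc : c ≠ 0) (x : Base n) :
    weingarten (dilation c u) x = c⁻¹ • weingarten u (c⁻¹ • x) := by
  rw [weingarten, metricTensor_dilation hc, secondFundamentalForm_dilation hc, Matrix.mul_smul,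
    weingarten]

theorem IsPrincipalCurvatureVector.dilation {x : Base n} {κ : Fin n → ℝ}
    (hκ : IsPrincipalCurvatureVector u (c⁻¹ • x) κ) (hc : c ≠ 0) :
    IsPrincipalCurvatureVector (dilation c u) x (c⁻¹ • κ) := by
  rw [IsPrincipalCurvatureVector, weingarten_dilation hc]
  exact charpoly_smul_eq_prod hκ (inv_ne_zero hc)

end Dilation

section CurvatureFunction

theorem exists_mem_frontier_forall_mem_of_notMem {X : Type*} [TopologicalSpace X] {U : Set X}
    (hU : IsOpen U) {l : ℝ → X} (hl : Continuous l) {a b : ℝ} (hab : a ≤ b) (ha : l a ∈ U)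
    (hb : l b ∉ U) : ∃ t ∈ Ioc a b, l t ∈ frontier U ∧ ∀ s ∈ Ico a t, l s ∈ U := by
  obtain ⟨t, ⟨htI, htU⟩, hleast⟩ :=
    (isCompact_Icc.inter_right (hU.isClosed_compl.preimage hl)).exists_isLeast
      ⟨b, right_mem_Icc.2 hab, hb⟩
  have hat : a < t := htI.1.lt_of_ne fun h => htU (h ▸ ha)
  have hmem : ∀ s ∈ Ico a t, l s ∈ U := fun s hs => by_contra fun hsU =>
    hs.2.not_ge (hleast ⟨⟨hs.1, hs.2.le.trans htI.2⟩, hsU⟩)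
  refine ⟨t, ⟨hat, htI.2⟩, hU.frontier_eq ▸ ⟨?_, htU⟩, hmem⟩
  exact MapsTo.closure hmem hl (by simp [closure_Ico hat.ne, hat.le])

variable {n : ℕ} {Γ : Set (Fin n → ℝ)} {γ : (Fin n → ℝ) → ℝ} {α : ℝ} {κ μ : Fin n → ℝ}

theorem IsCurvatureFunction.mem_of_pos (hγ : IsCurvatureFunction Γ γ α) (hκ : κ ∈ closure Γ)
    (hpos : 0 < γ κ) : κ ∈ Γ := by
  by_contra hκΓ
  exact hpos.ne' (hγ.eq_zero_of_mem_frontier κ (hγ.isOpen_cone.frontier_eq ▸ ⟨hκ, hκΓ⟩))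

theorem IsCurvatureFunction.differentiableAt (hγ : IsCurvatureFunction Γ γ α) (hκ : κ ∈ Γ) :
    DifferentiableAt ℝ γ κ :=
  (hγ.smooth.contDiffAt (hγ.isOpen_cone.mem_nhds hκ)).differentiableAt (by simp)

theorem IsCurvatureFunction.fderiv_nonneg (hγ : IsCurvatureFunction Γ γ α) (hκ : κ ∈ Γ)
    {v : Fin n → ℝ} (hv : 0 ≤ v) : 0 ≤ fderiv ℝ γ κ v := by
  rw [pi_eq_sum_univ' v, map_sum]
  refine Finset.sum_nonneg fun i _ => ?_
  rw [map_smul, smul_eq_mul]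
  exact mul_nonneg (hv i) (hγ.increasing κ hκ i).le

theorem IsCurvatureFunction.apply_le_apply_of_forall_mem (hγ : IsCurvatureFunction Γ γ α)
    {v : Fin n → ℝ} (hv : 0 ≤ v) {b : ℝ} (hb : 0 < b) (hΓ : ∀ t ∈ Ico 0 b, κ + t • v ∈ Γ) :
    γ κ ≤ γ (κ + b • v) := by
  have hcl : MapsTo (fun t : ℝ => κ + t • v) (Icc 0 b) (closure Γ) := by
    rw [← closure_Ico hb.ne]
    exact MapsTo.closure hΓ (by fun_prop)
  have hderiv (t : ℝ) (ht : t ∈ Ioo 0 b) := hasDerivAt_comp_add_smul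
    (hγ.differentiableAt (hΓ t (Ioo_subset_Ico_self ht)))
  have hmono : MonotoneOn (fun t : ℝ => γ (κ + t • v)) (Icc 0 b) := by
    refine monotoneOn_of_deriv_nonneg (convex_Icc 0 b)
      (hγ.continuousOn_closure.comp (by fun_prop) hcl) ?_ ?_ <;> rw [interior_Icc]
    · exact fun t ht => (hderiv t ht).differentiableAt.differentiableWithinAt
    · intro t ht
      rw [(hderiv t ht).deriv]
      exact hγ.fderiv_nonneg (hΓ t (Ioo_subset_Ico_self ht)) hv
  simpa using hmono (left_mem_Icc.2 hb.le) (right_mem_Icc.2 hb.le) hb.le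

/-- Along a segment leaving `Γ`, `γ` would increase from a positive value to `0`. -/
theorem IsCurvatureFunction.mem_of_le (hγ : IsCurvatureFunction Γ γ α) (hκ : κ ∈ Γ)
    (hκμ : κ ≤ μ) : μ ∈ Γ := by
  by_contra hμ
  obtain ⟨t, ht, hfrontier, hmem⟩ := exists_mem_frontier_forall_mem_of_notMem hγ.isOpen_cone
    (l := fun t : ℝ => κ + t • (μ - κ)) (by fun_prop) zero_le_one (by simpa) (by simpa)
  have hle := hγ.apply_le_apply_of_forall_mem (sub_nonneg.2 hκμ) ht.1 hmem
  rw [hγ.eq_zero_of_mem_frontier _ hfrontier] at hle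
  exact hle.not_gt (hγ.pos κ hκ)

theorem IsCurvatureFunction.monotoneOn (hγ : IsCurvatureFunction Γ γ α) : MonotoneOn γ Γ := by
  intro κ hκ μ _ hκμ
  simpa using hγ.apply_le_apply_of_forall_mem (sub_nonneg.2 hκμ) one_pos fun t ht =>
    hγ.mem_of_le hκ (le_add_of_nonneg_right (smul_nonneg ht.1 (sub_nonneg.2 hκμ)))

theorem IsCurvatureFunction.smul_comp_perm_lt (hγ : IsCurvatureFunction Γ γ α) (hκ : κ ∈ Γ)
    {c : ℝ} (hc : 0 < c) (hc1 : c < 1) (τ : Equiv.Perm (Fin n)) : γ (c • (κ ∘ τ)) < γ κ := by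
  rw [hγ.homogeneous _ (hγ.perm_mem κ hκ τ) c hc, hγ.symmetric κ hκ τ]
  exact mul_lt_of_lt_one_left (hγ.pos κ hκ) (Real.rpow_lt_one hc.le hc1 hγ.degree_pos)

end CurvatureFunction

section Translator

variable {n : ℕ} {Γ : Set (Fin n → ℝ)} {γ : (Fin n → ℝ) → ℝ} {α : ℝ}
  {Ω U : Set (Base n)} {u b : Base n → ℝ} {x : Base n}

theorem IsGraphicalTranslator.contDiffAt (hu : IsGraphicalTranslator Γ γ Ω u) (hΩ : IsOpen Ω)
    (hx : x ∈ Ω) : ContDiffAt ℝ 2 u x :=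
  contDiffAt_infty.1 (hu.smooth.contDiffAt (hΩ.mem_nhds hx)) 2

theorem IsGraphicalTranslator.exists_mem (hγ : IsCurvatureFunction Γ γ α)
    (hu : IsGraphicalTranslator Γ γ Ω u) (hx : x ∈ Ω) :
    ∃ κ ∈ Γ, IsPrincipalCurvatureVector u x κ ∧
      γ κ = inner ℝ (unitNormal u x) (vertical n) := by
  obtain ⟨κ, hκ, hκΓ, heq⟩ := hu.equation x hx
  exact ⟨κ, hγ.mem_of_pos hκΓ (heq ▸ inner_unitNormal_vertical_pos u x), hκ, heq⟩

theorem IsGraphicalTranslator.not_isLocalMin_dilation_sub (hγ : IsCurvatureFunction Γ γ α)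
    (hU : IsOpen U) (hb : IsGraphicalTranslator Γ γ U b) (hΩ : IsOpen Ω)
    (hu : IsGraphicalTranslator Γ γ Ω u) {c : ℝ} (hc : 1 < c) (hxU : c⁻¹ • x ∈ U) (hxΩ : x ∈ Ω) :
    ¬ IsLocalMin (dilation c b - u) x := by
  intro hmin
  have hc0 : 0 < c := zero_lt_one.trans hc
  have hux := hu.contDiffAt hΩ hxΩ
  have hbx : ContDiffAt ℝ 2 (dilation c b) x := contDiffAt_dilation (hb.contDiffAt hU hxU)
  obtain ⟨κ, hκΓ, hκ, hγκ⟩ := hu.exists_mem hγ hxΩ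
  obtain ⟨μ, hμΓ, hμ, hγμ⟩ := hb.exists_mem hγ hxU
  obtain ⟨τ, hτ⟩ := hκ.exists_perm_le_of_isLocalMin_sub (hμ.dilation hc0.ne') hux hbx hmin
  have heq : γ κ = γ μ := by
    rw [hγκ, hγμ, ← unitNormal_dilation hc0.ne', unitNormal_eq_of_isLocalMin_sub
      (hux.differentiableAt two_ne_zero) (hbx.differentiableAt two_ne_zero) hmin]
  have hlt : γ κ < γ μ := (hγ.monotoneOn hκΓ (hγ.mem_of_le hκΓ hτ) hτ).trans_lt
    (hγ.smul_comp_perm_lt hμΓ (inv_pos.2 hc0) (inv_lt_one_of_one_lt₀ hc) τ)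
  exact hlt.ne heq

end Translator

section IntrinsicDistance

theorem eVariationOn_le_of_edist_le {α E F : Type*} [LinearOrder α] [PseudoEMetricSpace E]
    [PseudoEMetricSpace F] {f : α → E} {g : α → F} {s : Set α}
    (h : ∀ x ∈ s, ∀ y ∈ s, x ≤ y → edist (f x) (f y) ≤ edist (g x) (g y)) :
    eVariationOn f s ≤ eVariationOn g s := by
  refine iSup_le fun ⟨N, p, hp, hps⟩ =>
    (Finset.sum_le_sum fun i _ => ?_).trans (eVariationOn.sum_le (n := N) hp hps)
  simpa only [edist_comm] using h _ (hps i) _ (hps (i + 1)) (hp i.le_succ)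

variable {n : ℕ} {S : Set (Ambient n)}

theorem edist_le_intrinsicEDist (S : Set (Ambient n)) (p q : Ambient n) :
    edist p q ≤ intrinsicEDist S p q := by
  refine le_iInf₂ fun c hc => ?_
  obtain ⟨-, -, rfl, rfl⟩ := hc
  exact eVariationOn.edist_le c (by simp) (by simp)

theorem intrinsicEDist_le_eVariationOn {c : ℝ → Ambient n} {a b : ℝ} (hab : a ≤ b)
    (hc : ContinuousOn c (Icc a b)) (hcS : MapsTo c (Icc a b) S) :
    intrinsicEDist S (c a) (c b) ≤ eVariationOn c (Icc a b) := by
  have hline : MapsTo (AffineMap.lineMap a b : ℝ → ℝ) (Icc 0 1) (Icc a b) :=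
    fun t ht => Convex.lineMap_mem (convex_Icc a b) (left_mem_Icc.2 hab) (right_mem_Icc.2 hab) ht
  refine (iInf₂_le (c ∘ AffineMap.lineMap a b) ⟨hc.comp (by fun_prop) hline, hcS.comp hline,
    by simp, by simp⟩).trans ?_
  exact eVariationOn.comp_le_of_monotoneOn c _ ((AffineMap.lineMap_mono hab).monotoneOn _) hline

theorem intrinsicEDist_comm (S : Set (Ambient n)) (p q : Ambient n) :
    intrinsicEDist S p q = intrinsicEDist S q p := by
  suffices hle : ∀ p q, intrinsicEDist S p q ≤ intrinsicEDist S q p from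
    (hle p q).antisymm (hle q p)
  refine fun p q => le_iInf₂ fun c ⟨hc, hcS, hc0, hc1⟩ => ?_
  have hmaps : MapsTo (fun t : ℝ => 1 - t) (Icc 0 1) (Icc 0 1) := fun t ht =>
    ⟨sub_nonneg.2 ht.2, sub_le_self 1 ht.1⟩
  refine (iInf₂_le (c ∘ fun t => 1 - t)
    ⟨hc.comp (by fun_prop) hmaps, hcS.comp hmaps, by simpa, by simpa⟩).trans ?_
  exact eVariationOn.comp_le_of_antitoneOn c _ (fun _ _ _ _ h => sub_le_sub_left h 1) hmaps

theorem dist_le_dist_point (x y : Base n) (s t : ℝ) :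
    dist x y ≤ dist (point x s) (point y t) := by
  refine (pow_le_pow_iff_left₀ dist_nonneg dist_nonneg two_ne_zero).1 ?_
  rw [dist_point_sq]
  exact le_add_of_nonneg_right (sq_nonneg _)

theorem dist_point_le (x y : Base n) (s t : ℝ) :
    dist (point x s) (point y t) ≤ dist x y + |s - t| := by
  refine (pow_le_pow_iff_left₀ dist_nonneg (by positivity) two_ne_zero).1 ?_
  rw [dist_point_sq, ← sq_abs (s - t)]
  exact pow_add_pow_le dist_nonneg (abs_nonneg _) two_ne_zero

variable {Ω : Set (Base n)} {u : Base n → ℝ} {x v : Base n}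

theorem continuousOn_graphMap (hu : ContinuousOn u Ω) : ContinuousOn (graphMap u) Ω :=
  (pointCLM n).continuous.comp_continuousOn (continuousOn_id.prodMk hu)

theorem tendsto_of_tendsto_intrinsicEDist_graphMap {y : ℕ → Base n}
    (h : Tendsto (fun k => intrinsicEDist S (graphMap u (y k)) (graphMap u x)) atTop (𝓝 0)) :
    Tendsto y atTop (𝓝 x) := by
  rw [tendsto_iff_edist_tendsto_0]
  refine tendsto_of_tendsto_of_tendsto_of_le_of_le tendsto_const_nhds h (fun _ => zero_le)
    fun k => le_trans ?_ (edist_le_intrinsicEDist S _ _)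
  rw [edist_dist, edist_dist]
  exact ENNReal.ofReal_le_ofReal (dist_le_dist_point _ _ _ _)

theorem edist_graphMap_add_smul_le {s t : ℝ} (hst : s ≤ t) (hle : u (x + s • v) ≤ u (x + t • v)) :
    edist (graphMap u (x + s • v)) (graphMap u (x + t • v)) ≤
      edist (s * ‖v‖ + u (x + s • v)) (t * ‖v‖ + u (x + t • v)) := by
  rw [edist_dist, edist_dist]
  refine ENNReal.ofReal_le_ofReal ((dist_point_le _ _ _ _).trans_eq ?_)
  have hs : s * ‖v‖ ≤ t * ‖v‖ := by gcongr
  rw [dist_add_left, dist_eq_norm, ← sub_smul, norm_smul, Real.norm_eq_abs, Real.dist_eq,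
    abs_of_nonpos (sub_nonpos.2 hst), abs_of_nonpos (sub_nonpos.2 hle),
    abs_of_nonpos (sub_nonpos.2 (add_le_add hs hle))]
  ring

theorem intrinsicEDist_graphMap_add_smul_le (hu : ContinuousOn u Ω) {a b : ℝ} (hab : a ≤ b)
    (hΩ : ∀ t ∈ Icc a b, x + t • v ∈ Ω) (hmono : MonotoneOn (fun t => u (x + t • v)) (Icc a b)) :
    intrinsicEDist (graphOver Ω u) (graphMap u (x + a • v)) (graphMap u (x + b • v)) ≤
      edist (a * ‖v‖ + u (x + a • v)) (b * ‖v‖ + u (x + b • v)) := by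
  have hψ : MonotoneOn (fun t => t * ‖v‖ + u (x + t • v)) (Icc a b) :=
    ((monotone_id.mul_const (norm_nonneg v)).monotoneOn _).add hmono
  have ha : a ∈ Icc a b := left_mem_Icc.2 hab
  have hb : b ∈ Icc a b := right_mem_Icc.2 hab
  calc _ ≤ eVariationOn (fun t => graphMap u (x + t • v)) (Icc a b) :=
        intrinsicEDist_le_eVariationOn hab ((continuousOn_graphMap hu).comp (by fun_prop) hΩ)
          fun t ht => mem_image_of_mem (graphMap u) (hΩ t ht)
    _ ≤ eVariationOn (fun t => t * ‖v‖ + u (x + t • v)) (Icc a b) :=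
        eVariationOn_le_of_edist_le fun s hs t ht hst =>
          edist_graphMap_add_smul_le hst (hmono hs ht hst)
    _ = _ := by
        rw [← inter_self (Icc a b), hψ.eVariationOn_eq ha hb, edist_comm, edist_dist, Real.dist_eq,
          abs_of_nonneg (sub_nonneg.2 (hψ ha hb hab))]

theorem exists_forall_intrinsicEDist_lt_of_monotoneOn (hu : ContinuousOn u Ω)
    (hΩ : ∀ t ∈ Ico (0 : ℝ) 1, x + t • v ∈ Ω)
    (hmono : MonotoneOn (fun t : ℝ => u (x + t • v)) (Ico 0 1)) {M : ℝ}
    (hM : ∀ t ∈ Ico (0 : ℝ) 1, u (x + t • v) ≤ M) {t : ℕ → ℝ} (ht : Monotone t)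
    (htI : ∀ k, t k ∈ Ico (0 : ℝ) 1) {ε : ℝ≥0∞} (hε : 0 < ε) :
    ∃ N, ∀ k ≥ N, ∀ m ≥ N, intrinsicEDist (graphOver Ω u) (graphMap u (x + t k • v))
      (graphMap u (x + t m • v)) < ε := by
  set ψ : ℕ → ℝ := fun k => t k * ‖v‖ + u (x + t k • v)
  have hψ : Monotone ψ := fun k m hkm =>
    add_le_add (mul_le_mul_of_nonneg_right (ht hkm) (norm_nonneg v))
      (hmono (htI k) (htI m) (ht hkm))
  have hψM : BddAbove (range ψ) := ⟨‖v‖ + M, by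
    rintro _ ⟨k, rfl⟩
    exact add_le_add (mul_le_of_le_one_left (norm_nonneg v) (htI k).2.le) (hM _ (htI k))⟩
  have hle (k m : ℕ) (hkm : k ≤ m) : intrinsicEDist (graphOver Ω u) (graphMap u (x + t k • v))
      (graphMap u (x + t m • v)) ≤ edist (ψ k) (ψ m) := by
    have hsub : Icc (t k) (t m) ⊆ Ico 0 1 := Icc_subset_Ico (htI k).1 (htI m).2
    exact intrinsicEDist_graphMap_add_smul_le hu (ht hkm) (fun s hs => hΩ s (hsub hs))
      (hmono.mono hsub)
  obtain ⟨N, hN⟩ := EMetric.cauchySeq_iff.1 (tendsto_atTop_ciSup hψ hψM).cauchySeq ε hε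
  refine ⟨N, fun k hk m hm => ?_⟩
  rcases le_total k m with hkm | hmk
  · exact (hle k m hkm).trans_lt (hN k hk m hm)
  · rw [intrinsicEDist_comm]
    exact (hle m k hmk).trans_lt (hN m hm k hk)

/-- A bounded increasing profile has finite length, so it would end at a point of the graph. -/
theorem IsIntrinsicallyComplete.tendsto_atTop_of_monotoneOn
    (hcomplete : IsIntrinsicallyComplete (graphOver Ω u)) (hu : ContinuousOn u Ω)
    (hΩ : ∀ t ∈ Ico (0 : ℝ) 1, x + t • v ∈ Ω) (hxv : x + v ∉ Ω)
    (hmono : MonotoneOn (fun t : ℝ => u (x + t • v)) (Ico 0 1)) :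
    Tendsto (fun t : ℝ => u (x + t • v)) (𝓝[<] 1) atTop := by
  refine tendsto_atTop.2 fun M => ?_
  suffices hunbdd : ∃ t ∈ Ico (0 : ℝ) 1, M < u (x + t • v) by
    obtain ⟨t, ht, hMt⟩ := hunbdd
    filter_upwards [Ioo_mem_nhdsLT ht.2] with s hs
    exact hMt.le.trans (hmono ht ⟨ht.1.trans hs.1.le, hs.2⟩ hs.1.le)
  by_contra! hbdd
  obtain ⟨t, ht, htI, ht1⟩ := exists_seq_strictMono_tendsto' (zero_lt_one (α := ℝ))
  have htI' (k : ℕ) : t k ∈ Ico (0 : ℝ) 1 := Ioo_subset_Ico_self (htI k)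
  obtain ⟨_, ⟨y, hy, rfl⟩, hlim⟩ := hcomplete (fun k => graphMap u (x + t k • v))
    (fun k => ⟨_, hΩ _ (htI' k), rfl⟩)
    fun ε => exists_forall_intrinsicEDist_lt_of_monotoneOn hu hΩ hmono hbdd ht.monotone htI'
  have hend : Tendsto (fun k => x + t k • v) atTop (𝓝 (x + v)) := by
    simpa using (ht1.smul_const v).const_add x
  rw [tendsto_nhds_unique (tendsto_of_tendsto_intrinsicEDist_graphMap hlim) hend] at hy
  exact hxv hy

end IntrinsicDistance

section Bowl

theorem monotoneOn_of_convexOn_of_even {f : ℝ → ℝ} {R : ℝ} (hf : ConvexOn ℝ (Ioo (-R) R) f)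
    (heven : ∀ t ∈ Ico 0 R, f (-t) = f t) : MonotoneOn f (Ico 0 R) := by
  intro s hs t ht hst
  have hle := hf.le_max_of_mem_Icc ⟨neg_lt_neg ht.2, by linarith [ht.1, ht.2]⟩
    ⟨by linarith [ht.1, ht.2], ht.2⟩ (z := s) ⟨by linarith [hs.1, ht.1], hst⟩
  rwa [heven t ht, max_self] at hle

variable {n : ℕ} {Γ : Set (Fin n → ℝ)} {γ : (Fin n → ℝ) → ℝ} {r : ℝ} {b : Base n → ℝ}

theorem IsBowlOverBall.fderiv_fderiv_nonneg (hb : IsBowlOverBall Γ γ r b) {x : Base n}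
    (hx : x ∈ Metric.ball 0 r) (v : Base n) : 0 ≤ fderiv ℝ (fderiv ℝ b) x v v := by
  obtain ⟨κ, hκ, -⟩ := hb.translator.equation x hx
  exact hκ.fderiv_fderiv_nonneg (hb.translator.contDiffAt Metric.isOpen_ball hx)
    (fun i => (hb.strictly_convex x hx κ hκ i).le) v

theorem smul_mem_ball_of_norm_eq {E : Type*} [SeminormedAddCommGroup E] [NormedSpace ℝ E] {p : E}
    (hr : 0 < r) (hp : ‖p‖ = r) {t : ℝ} : t • p ∈ Metric.ball 0 r ↔ t ∈ Ioo (-1) 1 := by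
  rw [mem_ball_zero_iff, norm_smul, hp, mul_lt_iff_lt_one_left hr, Real.norm_eq_abs, abs_lt,
    mem_Ioo]

theorem IsBowlOverBall.monotoneOn_smul (hr : 0 < r) (hb : IsBowlOverBall Γ γ r b) {p : Base n}
    (hp : ‖p‖ = r) : MonotoneOn (fun t : ℝ => b (t • p)) (Ico 0 1) := by
  refine monotoneOn_of_convexOn_of_even ?_ fun t ht => ?_
  · simpa using convexOn_comp_add_smul (x := 0) (v := p)
      (fun x hx => hb.translator.contDiffAt Metric.isOpen_ball hx)
      (fun x hx => hb.fderiv_fderiv_nonneg hx p) (convex_Ioo (-1) 1)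
      fun t ht => by simpa [smul_mem_ball_of_norm_eq hr hp] using ht
  · have ht' : t • p ∈ Metric.ball 0 r :=
      (smul_mem_ball_of_norm_eq hr hp).2 ⟨neg_one_lt_zero.trans_le ht.1, ht.2⟩
    rw [neg_smul]
    exact hb.rotationally_symmetric _ (by simpa using ht') _ ht' (norm_neg _)

theorem IsBowlOverBall.tendsto_smul_atTop (hr : 0 < r) (hb : IsBowlOverBall Γ γ r b) {p : Base n}
    (hp : ‖p‖ = r) : Tendsto (fun t : ℝ => b (t • p)) (𝓝[<] 1) atTop := by
  simpa using hb.complete.tendsto_atTop_of_monotoneOn (x := 0) (v := p)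
    hb.translator.smooth.continuousOn
    (fun t ht => by
      simpa [smul_mem_ball_of_norm_eq hr hp] using ⟨neg_one_lt_zero.trans_le ht.1, ht.2⟩)
    (by simp [hp]) (by simpa using hb.monotoneOn_smul hr hp)

theorem IsBowlOverBall.tendsto_atTop (hr : 0 < r) (hb : IsBowlOverBall Γ γ r b) {p : Base n}
    (hp : ‖p‖ = r) : Tendsto b (𝓝[Metric.ball 0 r] p) atTop := by
  have hratio : Tendsto (fun x : Base n => ‖x‖ / r) (𝓝[Metric.ball 0 r] p) (𝓝[<] 1) := by
    refine tendsto_nhdsWithin_iff.2 ⟨?_, ?_⟩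
    · have hcont : ContinuousAt (fun x : Base n => ‖x‖ / r) p := by fun_prop
      simpa [ContinuousAt, hp, hr.ne'] using hcont.tendsto.mono_left nhdsWithin_le_nhds
    · filter_upwards [self_mem_nhdsWithin] with x hx
      exact (div_lt_one hr).2 (mem_ball_zero_iff.1 hx)
  refine ((hb.tendsto_smul_atTop hr hp).comp hratio).congr' ?_
  filter_upwards [self_mem_nhdsWithin] with x hx
  have hnorm : ‖(‖x‖ / r) • p‖ = ‖x‖ := by
    rw [norm_smul, hp, norm_div, norm_norm, Real.norm_of_nonneg hr.le, div_mul_cancel₀ _ hr.ne']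
  exact hb.rotationally_symmetric _ (by simpa [hnorm] using hx) _ hx hnorm

end Bowl

section Touching

theorem exists_isMinOn_of_eventually_frontier_le {X β : Type*} [TopologicalSpace X] [LinearOrder β]
    [TopologicalSpace β] [ClosedIicTopology β] {U : Set X} (hU : IsOpen U)
    (hUc : IsCompact (closure U)) {f : X → β} (hf : ContinuousOn f U) {a : X} (ha : a ∈ U)
    (hle : ∀ p ∈ frontier U, ∀ᶠ x in 𝓝[U] p, f a ≤ f x) : ∃ x ∈ U, IsMinOn f U x := by
  simp only [eventually_nhdsWithin_iff] at hle
  obtain ⟨W, hWo, hW, hfW⟩ := eventually_nhdsSet_iff_exists.1 (eventually_nhdsSet_iff_forall.2 hle)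
  have hKU : insert a (closure U \ W) ⊆ U := insert_subset ha fun x hx => by_contra fun hxU =>
    hx.2 (hW (hU.frontier_eq ▸ ⟨hx.1, hxU⟩))
  obtain ⟨x, hx, hmin⟩ := ((hUc.diff hWo).insert a).exists_isMinOn (insert_nonempty _ _)
    (hf.mono hKU)
  refine ⟨x, hKU hx, fun y hy => ?_⟩
  by_cases hyW : y ∈ W
  · exact (hmin (mem_insert a _)).trans (hfW y hyW hy)
  · exact hmin (mem_insert_of_mem _ ⟨subset_closure hy, hyW⟩)

theorem exists_one_lt_forall_smul_mem {E : Type*} [TopologicalSpace E] [MulAction ℝ E]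
    [ContinuousSMul ℝ E] {K Ω : Set E} (hK : IsCompact K) (hΩ : IsOpen Ω) (hKΩ : K ⊆ Ω) :
    ∃ c : ℝ, 1 < c ∧ ∀ x ∈ K, c • x ∈ Ω := by
  have hev : ∀ᶠ c : ℝ in 𝓝 1, ∀ x ∈ K, c • x ∈ Ω :=
    hK.eventually_forall_of_forall_eventually fun x hx =>
      continuous_smul.continuousAt.eventually (hΩ.mem_nhds (by simpa using hKΩ hx))
  exact ((eventually_mem_nhdsWithin (s := Ioi (1 : ℝ))).and
    (hev.filter_mono nhdsWithin_le_nhds)).exists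

variable {n : ℕ} {Γ : Set (Fin n → ℝ)} {γ : (Fin n → ℝ) → ℝ} {r : ℝ} {b : Base n → ℝ}

theorem isLocalMin_dilation_sub {c : ℝ} (hc : c ≠ 0) {u : Base n → ℝ} {y : Base n}
    (hmin : IsLocalMin (fun y => c * b y - u (c • y)) y) :
    IsLocalMin (dilation c b - u) (c • y) := by
  have hcont : ContinuousAt (fun x : Base n => c⁻¹ • x) (c • y) := by fun_prop
  rw [← inv_smul_smul₀ hc y] at hmin
  simpa [Function.comp_def, dilation, hc, IsLocalMin, IsMinFilter] using hcont.eventually hmin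

theorem IsBowlOverBall.exists_isLocalMin_dilation_sub (hr : 0 < r) (hb : IsBowlOverBall Γ γ r b)
    {Ω : Set (Base n)} {u : Base n → ℝ} (hu : ContinuousOn u Ω) (hΩ : IsOpen Ω) {c : ℝ}
    (hc : 0 < c) (hrΩ : ∀ y ∈ Metric.closedBall 0 r, c • y ∈ Ω) :
    ∃ y ∈ Metric.ball 0 r, IsLocalMin (dilation c b - u) (c • y) := by
  have hcu (y : Base n) (hy : y ∈ Metric.closedBall 0 r) :
      ContinuousAt (fun y => u (c • y)) y :=
    ContinuousAt.comp' (hu.continuousAt (hΩ.mem_nhds (hrΩ y hy)))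
      (continuous_const_smul c).continuousAt
  have hf : ContinuousOn (fun y => c * b y - u (c • y)) (Metric.ball 0 r) :=
    (continuousOn_const.mul hb.translator.smooth.continuousOn).sub fun y hy =>
      (hcu y (Metric.ball_subset_closedBall hy)).continuousWithinAt
  have hblowup (p : Base n) (hp : p ∈ frontier (Metric.ball 0 r)) :
      Tendsto (fun y => c * b y - u (c • y)) (𝓝[Metric.ball 0 r] p) atTop := by
    rw [frontier_ball _ hr.ne'] at hp
    simp only [sub_eq_add_neg]
    exact ((hb.tendsto_atTop hr (mem_sphere_zero_iff_norm.1 hp)).const_mul_atTop hc).atTop_add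
      ((hcu p (Metric.sphere_subset_closedBall hp)).neg.mono_left nhdsWithin_le_nhds)
  obtain ⟨y, hy, hmin⟩ := exists_isMinOn_of_eventually_frontier_le Metric.isOpen_ball
    Metric.isBounded_ball.isCompact_closure hf (Metric.mem_ball_self hr)
    fun p hp => (hblowup p hp).eventually_ge_atTop _
  exact ⟨y, hy, isLocalMin_dilation_sub hc.ne' (hmin.isLocalMin (Metric.isOpen_ball.mem_nhds hy))⟩

end Touching

end GammaTranslator

theorem corollary1p3_general {n : ℕ} {Γ : Set (Fin n → ℝ)} {γ : (Fin n → ℝ) → ℝ} {α : ℝ}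
    (hγ : GammaTranslator.IsCurvatureFunction Γ γ α) {r : ℝ} (hr : 0 < r)
    {b : EuclideanSpace ℝ (Fin n) → ℝ} (hb : GammaTranslator.IsBowlOverBall Γ γ r b)
    {Ω : Set (EuclideanSpace ℝ (Fin n))} (hΩ : IsOpen Ω) (hrΩ : Metric.closedBall 0 r ⊆ Ω) :
    ¬ ∃ u : EuclideanSpace ℝ (Fin n) → ℝ, GammaTranslator.IsGraphicalTranslator Γ γ Ω u := by
  rintro ⟨u, hu⟩
  obtain ⟨c, hc, hcΩ⟩ :=
    GammaTranslator.exists_one_lt_forall_smul_mem (isCompact_closedBall 0 r) hΩ hrΩ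
  have hc0 : 0 < c := zero_lt_one.trans hc
  obtain ⟨y, hy, hmin⟩ := hb.exists_isLocalMin_dilation_sub hr hu.smooth.continuousOn hΩ hc0 hcΩ
  exact hb.translator.not_isLocalMin_dilation_sub hγ Metric.isOpen_ball hΩ hu hc
    (by rwa [inv_smul_smul₀ hc0.ne']) (hcΩ y (Metric.ball_subset_closedBall hy)) hmin

theorem corollary1p3 {n : ℕ} (hn : 1 ≤ n) (Γ : Set (Fin n → ℝ)) (γ : (Fin n → ℝ) → ℝ) (α : ℝ)
    (hγ : GammaTranslator.IsCurvatureFunction Γ γ α) (hα : 1 / 2 < α)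
    (hbowl : ∃ r : ℝ, 0 < r ∧ ∃ b : EuclideanSpace ℝ (Fin n) → ℝ,
      GammaTranslator.IsBowlOverBall Γ γ r b) :
    ¬ ∃ u : EuclideanSpace ℝ (Fin n) → ℝ,
      GammaTranslator.IsCompleteConvexEntireTranslator Γ γ u := by
  obtain ⟨r, hr, b, hb⟩ := hbowl
  exact fun ⟨u, hu⟩ =>
    corollary1p3_general hγ hr hb isOpen_univ (subset_univ _) ⟨u, hu.translator⟩
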